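/- Let $k\ge 1$, $0\le\mu\le k-1$ and $m,n\ge 0$ be integers, let $x_1,\dots,x_k\in\mathbb{C}$ be nodes (not necessarily distinct), and put $\gamma_j(\lambda)=\lambda-x_j$, $n_i(\lambda)=\prod_{j=1}^{i}\gamma_j(\lambda)$ (so $n_0=1$). Let $P(\lambda)=\sum_{i=0}^k P_i\,n_i(\lambda)$ with arbitrary $P_0,\dots,P_k\in\mathbb{C}^{m\times n}$, considered as a matrix polynomial of grade $k$. Define the block bidiagonal pencils $$K_1^N(\lambda)=\begin{bmatrix}-I_n&\gamma_{k-1}(\lambda)I_n\\&\ddots&\ddots\\&&-I_n&\gamma_{\mu+1}(\lambda)I_n\end{bmatrix},\qquad K_2^N(\lambda)=\begin{bmatrix}-I_m&\gamma_{\mu}(\lambda)I_m\\&\ddots&\ddots\\&&-I_m&\gamma_{1}(\lambda)I_m\end{bmatrix}$$ with $(k-\mu-1)\times(k-\mu)$ blocks and $\mu\times(\mu+1)$ blocks, respectively ($K_1^N$ has no rows if $\mu=k-1$, and $K_2^N$ has no rows if $\mu=0$). Let $M_\mu^N(\lambda)$ be the $(\mu+1)\times(k-\mu)$ block pencil with $m\times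 n$ blocks whose first block row is $\gamma_k(\lambda)P_k+P_{k-1},\,P_{k-2},\dots,P_{\mu+1},\,P_\mu$, whose last block column continues below the first block row with $P_{\mu-1},\dots,P_1,P_0$, and whose other blocks are $0$ (for $\mu=k-1$ the only block column is $\gamma_k(\lambda)P_k+P_{k-1},P_{k-2},\dots,P_0$). Then the colleague Newton pencil $$N_P^\mu(\lambda)=\begin{bmatrix}M_\mu^N(\lambda)&K_2^N(\lambda)^T\\K_1^N(\lambda)&0\end{bmatrix}$$ and, for arbitrary constant complex matrices $A$ of size $(\mu+1)m\times(k-\mu-1)n$ and $B$ of size $\mu m\times(k-\mu)n$, the pencil $$\mathcal N(\lambda)=\begin{bmatrix}M_\mu^N(\lambda)+A\,K_1^N(\lambda)+K_2^N(\lambda)^TB&K_2^N(\lambda)^T\\K_1^N(\lambda)&0\end{bmatrix}$$ are strong block minimal basis pencils and strong linearizations of $P(\lambda)$. Here a pencil $L$ is a linearization of $P$ if $U(\lambda)L(\lambda)V(\lambda)=\operatorname{diag}(I_s,P(\lambda))$ for some integer $s\ge 0$ and some matrix polynomials $U,V$ with nonzero constant determinants. It is a strong linearization of $P$ (of grade $k$)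 if, moreover, $\operatorname{rev}_1L$ is a linearization of $\operatorname{rev}_kP$, where $\operatorname{rev}_kP(\lambda)=\lambda^kP(1/\lambda)$. A matrix polynomial is a minimal basis if its rows are linearly independent over $\mathbb{C}(\lambda)$ and have the least sum of degrees among all bases, consisting of polynomial vectors, of the rational subspace that they span. Two minimal bases $K\in\mathbb{C}[\lambda]^{m_1\times N}$ and $D\in\mathbb{C}[\lambda]^{m_2\times N}$ are dual if $m_1+m_2=N$ and $KD^T=0$. A pencil $\begin{bmatrix}M&K_2^T\\K_1&0\end{bmatrix}$ is a strong block minimal basis pencil if, for $i=1,2$, $K_i$ is a minimal basis with all row degrees equal to $1$ and there is a minimal basis dual to $K_i$ whose row degrees are all equal. -/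

import Mathlib

open Polynomial

noncomputable section

/-! Matrix polynomials are matrices over `ℂ[X]`. A matrix made of `r × c` blocks of size `m × n` is
indexed by `Fin r × Fin m` and `Fin c × Fin n`: the index `(i, a)` is the `a`-th row (column) of the
`i`-th block row (block column), counted from zero. -/

/-- The matrix polynomial has grade `k`: its entries have degree at most `k`. -/
def HasGrade {α β : Type*} (k : ℕ) (P : Matrix α β ℂ[X]) : Prop :=
  ∀ i j, (P i j).natDegree ≤ k

/-- The `k`-reversal `λ ^ k * P (1 / λ)` of a matrix polynomial of grade `k`. -/
def matrixRev {α β : Type*} (k : ℕ) (P : Matrix α β ℂ[X]) : Matrix α β ℂ[X] :=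
  P.map (Polynomial.reflect k)

/-- A square matrix polynomial whose determinant is a nonzero constant. -/
def IsUnimodular {α : Type*} [Fintype α] [DecidableEq α] (U : Matrix α α ℂ[X]) : Prop :=
  ∃ c : ℂ, c ≠ 0 ∧ U.det = C c

/-- The pencil `L` is a linearization of `P`: `U * L * V` is the block diagonal matrix
`diag (I_s, P)` for some unimodular `U` and `V` and some `s`. The bijections `e` and `f` only
identify the row and column indices of `L` with those of `diag (I_s, P)`. -/
def IsLinearization {α β ι κ : Type*} [Fintype α] [DecidableEq α] [Fintype β] [DecidableEq β]
    (L : Matrix α β ℂ[X]) (P : Matrix ι κ ℂ[X]) : Prop :=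
  HasGrade 1 L ∧
    ∃ (s : ℕ) (e : α ≃ Fin s ⊕ ι) (f : β ≃ Fin s ⊕ κ)
      (U : Matrix α α ℂ[X]) (V : Matrix β β ℂ[X]),
      IsUnimodular U ∧ IsUnimodular V ∧
        Matrix.reindex e f (U * L * V) = Matrix.fromBlocks 1 0 0 P

/-- `L` is a strong linearization of `P`, considered as a matrix polynomial of grade `k`. -/
def IsStrongLinearization {α β ι κ : Type*} [Fintype α] [DecidableEq α] [Fintype β]
    [DecidableEq β] (k : ℕ) (L : Matrix α β ℂ[X]) (P : Matrix ι κ ℂ[X]) : Prop :=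
  HasGrade k P ∧ IsLinearization L P ∧ IsLinearization (matrixRev 1 L) (matrixRev k P)

/-- The `i`-th row of a matrix polynomial, as a vector over the field `ℂ(X)`. -/
def ratRow {α β : Type*} (K : Matrix α β ℂ[X]) (i : α) : β → RatFunc ℂ :=
  fun j => algebraMap ℂ[X] (RatFunc ℂ) (K i j)

/-- The degree of the `i`-th row. -/
def rowDegree {α β : Type*} [Fintype β] (K : Matrix α β ℂ[X]) (i : α) : ℕ :=
  Finset.univ.sup fun j => (K i j).natDegree

/-- The rows of `K` are a minimal basis of the rational subspace they span: they are linearly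
independent, and the sum of their degrees is least among all polynomial bases of that subspace. -/
def IsMinimalBasis {α β : Type*} [Fintype α] [Fintype β] (K : Matrix α β ℂ[X]) : Prop :=
  LinearIndependent (RatFunc ℂ) (ratRow K) ∧
    ∀ G : Matrix α β ℂ[X], LinearIndependent (RatFunc ℂ) (ratRow G) →
      Submodule.span (RatFunc ℂ) (Set.range (ratRow G)) =
        Submodule.span (RatFunc ℂ) (Set.range (ratRow K)) →
      ∑ i, rowDegree K i ≤ ∑ i, rowDegree G i

/-- `K` and `D` are dual minimal bases. -/
def AreDualMinimalBases {α δ β : Type*} [Fintype α] [Fintype δ] [Fintype β]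
    (K : Matrix α β ℂ[X]) (D : Matrix δ β ℂ[X]) : Prop :=
  IsMinimalBasis K ∧ IsMinimalBasis D ∧
    Fintype.card α + Fintype.card δ = Fintype.card β ∧ K * D.transpose = 0

/-- `K` is a minimal basis all of whose row degrees are `1`, and the row degrees of a minimal basis
dual to `K` are all equal. -/
def IsStrongWing {α β : Type*} [Fintype α] [Fintype β] (K : Matrix α β ℂ[X]) : Prop :=
  IsMinimalBasis K ∧ (∀ i, rowDegree K i = 1) ∧
    ∃ (d : ℕ) (D : Matrix (Fin d) β ℂ[X]) (e : ℕ),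
      AreDualMinimalBases K D ∧ ∀ i, rowDegree D i = e

/-- `L` is a strong block minimal basis pencil: `L = [M, K₂ᵀ; K₁, 0]` is a pencil and `K₁`, `K₂`
are minimal bases with the required row degrees. -/
def IsStrongBlockMinimalBasisPencil {α₁ β₁ α₂ β₂ : Type*} [Fintype α₁] [Fintype β₁] [Fintype α₂]
    [Fintype β₂] (L : Matrix (β₂ ⊕ α₁) (β₁ ⊕ α₂) ℂ[X]) : Prop :=
  HasGrade 1 L ∧
    ∃ (M : Matrix β₂ β₁ ℂ[X]) (K₁ : Matrix α₁ β₁ ℂ[X]) (K₂ : Matrix α₂ β₂ ℂ[X]),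
      L = Matrix.fromBlocks M K₂.transpose K₁ 0 ∧ IsStrongWing K₁ ∧ IsStrongWing K₂

/-- `γ_j = λ - x_j`, for nodes `x 1, x 2, …`. -/
def nodeFactor (x : ℕ → ℂ) (j : ℕ) : ℂ[X] := X - C (x j)

/-- The Newton polynomial `n_i = (λ - x_1) ⋯ (λ - x_i)`. -/
def newtonPoly (x : ℕ → ℂ) (i : ℕ) : ℂ[X] := ∏ j ∈ Finset.Icc 1 i, nodeFactor x j

/-- The matrix polynomial `∑ i = 0, …, k, P_i n_i`. -/
def newtonMatrixPoly {m n : ℕ} (k : ℕ) (x : ℕ → ℂ) (P : ℕ → Matrix (Fin m) (Fin n) ℂ) :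
    Matrix (Fin m) (Fin n) ℂ[X] :=
  ∑ i ∈ Finset.range (k + 1), newtonPoly x i • (P i).map C

/-- The block bidiagonal matrix with `r` block rows and `c` block columns (of blocks of size `n`)
whose block row number `i` (from zero) has `-I_n` in position `i` and `g i • I_n` in
position `i + 1`. -/
def blockBidiagonal (r c n : ℕ) (g : ℕ → ℂ[X]) :
    Matrix (Fin r × Fin n) (Fin c × Fin n) ℂ[X] :=
  Matrix.of fun i j =>
    if i.2 = j.2 then
      if (j.1 : ℕ) = i.1 then -1 else if (j.1 : ℕ) = i.1 + 1 then g i.1 else 0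
    else 0

/-- The pencil `K₁ᴺ`, with the superdiagonal factors `γ_{k-1}, …, γ_{μ+1}`. -/
def newtonK₁ (k μ n : ℕ) (x : ℕ → ℂ) :
    Matrix (Fin (k - μ - 1) × Fin n) (Fin (k - μ) × Fin n) ℂ[X] :=
  blockBidiagonal (k - μ - 1) (k - μ) n fun i => nodeFactor x (k - 1 - i)

/-- The pencil `K₂ᴺ`, with the superdiagonal factors `γ_μ, …, γ_1`. -/
def newtonK₂ (μ m : ℕ) (x : ℕ → ℂ) :
    Matrix (Fin μ × Fin m) (Fin (μ + 1) × Fin m) ℂ[X] :=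
  blockBidiagonal μ (μ + 1) m fun i => nodeFactor x (μ - i)

/-- The body `M_μᴺ`: its first block row is `γ_k P_k + P_{k-1}, P_{k-2}, …, P_{μ+1}, P_μ`, its last
block column continues downwards with `P_{μ-1}, …, P_1, P_0`, and all other blocks are zero. If
`μ = k - 1`, the only block column starts with `γ_k P_k + P_{k-1}`. -/
def newtonBody {m n : ℕ} (k μ : ℕ) (x : ℕ → ℂ) (P : ℕ → Matrix (Fin m) (Fin n) ℂ) :
    Matrix (Fin (μ + 1) × Fin m) (Fin (k - μ) × Fin n) ℂ[X] :=
  Matrix.of fun i j =>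
    if (i.1 : ℕ) = 0 then
      if (j.1 : ℕ) = 0 then nodeFactor x k * C (P k i.2 j.2) + C (P (k - 1) i.2 j.2)
      else C (P (k - 1 - j.1) i.2 j.2)
    else if (j.1 : ℕ) = k - μ - 1 then C (P (μ - i.1) i.2 j.2)
    else 0

/-- The matrix `[M, (K₂ᴺ)ᵀ; K₁ᴺ, 0]` with body `M`. -/
def newtonPencil {m n : ℕ} (k μ : ℕ) (x : ℕ → ℂ)
    (M : Matrix (Fin (μ + 1) × Fin m) (Fin (k - μ) × Fin n) ℂ[X]) :
    Matrix ((Fin (μ + 1) × Fin m) ⊕ (Fin (k - μ - 1) × Fin n))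
      ((Fin (k - μ) × Fin n) ⊕ (Fin μ × Fin m)) ℂ[X] :=
  Matrix.fromBlocks M (newtonK₂ μ m x).transpose (newtonK₁ k μ n x) 0

end

/-! Each `Kᵢ` has an explicit dual `Dᵢ` made of partial products of the node factors, and `D₂ * M *
D₁ᵀ = P` for the Newton body `M` (`newtonMatrixPoly_eq`). The terms `A * K₁` and `K₂ᵀ * B` do not
change this product, since `D₁ᵀ` and `D₂` annihilate them.

Everything else rests on right inverses over `ℂ[X]` of `Kᵢ`, `Dᵢ` and their reversals
(`IsDualPair`). Right invertibility makes every polynomial vector of the row space a polynomial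
combination of the rows; right invertibility of the reversal makes the leading coefficient matrix of
full row rank. Together they give minimality (`isMinimalBasis_of_mul_eq_one`). Right inverses of
`Kᵢ` and `Dᵢ` also supply the unimodular matrices that reduce the pencil to `diag (1, D₂ * M * D₁ᵀ)`
(`isLinearization_fromBlocks`). Reversal is multiplicative on graded matrices, so the same reduction
applied to the reversed data gives strongness. -/

/-! ### Minimal bases from right inverses -/

theorem linearIndependent_ratRow_of_mul_eq_one {α β : Type*} [Fintype α] [DecidableEq α]
    [Fintype β] {K : Matrix α β ℂ[X]} {R : Matrix β α ℂ[X]} (h : K * R = 1) :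
    LinearIndependent (RatFunc ℂ) (ratRow K) := by
  rw [show ratRow K = (K.map (algebraMap ℂ[X] (RatFunc ℂ))).row from rfl,
    ← Matrix.vecMul_injective_iff]
  refine Function.LeftInverse.injective
    (g := fun v => Matrix.vecMul v (R.map (algebraMap ℂ[X] (RatFunc ℂ)))) fun v => ?_
  simp only [Matrix.vecMul_vecMul, ← Matrix.map_mul, h]
  simp

/-- Every polynomial vector in the rational span of the rows of a right invertible matrix is a
polynomial combination of these rows. -/
theorem exists_vecMul_eq_of_mem_span {α β : Type*} [Fintype α] [DecidableEq α]
    [Fintype β] {K : Matrix α β ℂ[X]} {R : Matrix β α ℂ[X]} (h : K * R = 1) {g : β → ℂ[X]}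
    (hg : (fun j => algebraMap ℂ[X] (RatFunc ℂ) (g j)) ∈
      Submodule.span (RatFunc ℂ) (Set.range (ratRow K))) :
    ∃ t : α → ℂ[X], Matrix.vecMul t K = g := by
  obtain ⟨c, hc⟩ := (Submodule.mem_span_range_iff_exists_fun _).1 hg
  have hc' : Matrix.vecMul c (K.map (algebraMap ℂ[X] (RatFunc ℂ))) =
      fun j => algebraMap ℂ[X] (RatFunc ℂ) (g j) := by
    rw [← hc]
    ext j
    simp [Matrix.vecMul, dotProduct, ratRow, Finset.sum_apply]
  -- Multiplying `c * K = g` by `R` recovers the rational coefficients as `g * R`, which is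
  -- polynomial.
  have hc2 : c = fun i => algebraMap ℂ[X] (RatFunc ℂ) (Matrix.vecMul g R i) := by
    have h1 := congrArg (fun v => Matrix.vecMul v (R.map (algebraMap ℂ[X] (RatFunc ℂ)))) hc'
    simp only [Matrix.vecMul_vecMul, ← Matrix.map_mul, h] at h1
    rw [Matrix.map_one _ (map_zero _) (map_one _), Matrix.vecMul_one] at h1
    rw [h1]
    ext i
    simp [Matrix.vecMul, dotProduct]
  refine ⟨Matrix.vecMul g R, ?_⟩
  ext1 j
  apply RatFunc.algebraMap_injective ℂ
  rw [← congrFun hc' j, hc2]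
  simp [Matrix.vecMul, dotProduct]

/-- A nonzero polynomial combination of rows with independent coefficients of degree `e` has
degree at least `e`. -/
theorem le_sup_natDegree_vecMul {α β : Type*} [Fintype α] [DecidableEq α] [Fintype β] {e : ℕ}
    {K : Matrix α β ℂ[X]} (hK : HasGrade e K) {S : Matrix β α ℂ}
    (hS : K.map (fun p => p.coeff e) * S = 1) {t : α → ℂ[X]} (ht : t ≠ 0) :
    e ≤ Finset.univ.sup fun j => (Matrix.vecMul t K j).natDegree := by
  by_contra! hlt
  set N := Finset.univ.sup fun i => (t i).natDegree with hN
  have htN : ∀ i, (t i).natDegree ≤ N := fun i =>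
    Finset.le_sup (f := fun i => (t i).natDegree) (Finset.mem_univ i)
  -- The coefficient of degree `N + e` of `t * K` involves only the top coefficients of `t` and `K`;
  -- it vanishes because the degree is below `e`.
  have hz : Matrix.vecMul (fun i => (t i).coeff N) (K.map fun p => p.coeff e) = 0 := by
    ext1 j
    have hj : (Matrix.vecMul t K j).natDegree < N + e :=
      lt_of_le_of_lt (Finset.le_sup (f := fun j => (Matrix.vecMul t K j).natDegree)
        (Finset.mem_univ j)) (by omega)
    have := coeff_eq_zero_of_natDegree_lt hj
    simp only [Matrix.vecMul, dotProduct, finsetSum_coeff] at this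
    simp only [Matrix.vecMul, dotProduct, Matrix.map_apply, Pi.zero_apply]
    rw [← this]
    exact Finset.sum_congr rfl fun i _ =>
      (coeff_mul_add_eq_of_natDegree_le (htN i) (hK i j)).symm
  have hcoeff : (fun i => (t i).coeff N) = 0 := by
    have h1 := congrArg (fun v => Matrix.vecMul v S) hz
    simpa [Matrix.vecMul_vecMul, hS] using h1
  obtain ⟨i₀, hi₀⟩ := Function.ne_iff.1 ht
  obtain ⟨i, -, hi⟩ := Finset.exists_mem_eq_sup Finset.univ ⟨i₀, Finset.mem_univ i₀⟩
    fun i => (t i).natDegree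
  -- The index `i` attains the maximal degree `N`, so its leading coefficient is one of those just
  -- shown to vanish. This forces `N = 0`, and then all of `t` is constant and zero.
  have hti : t i = 0 := by
    rw [← leadingCoeff_eq_zero, leadingCoeff, ← hi]
    exact congrFun hcoeff i
  have hN0 : N = 0 := by rw [hN, hi, hti, natDegree_zero]
  apply hi₀
  rw [eq_C_of_natDegree_le_zero ((htN i₀).trans hN0.le), ← hN0, show (t i₀).coeff N = 0 from
    congrFun hcoeff i₀]
  simp

theorem rowDegree_eq_of_hasGrade {α β : Type*} [Fintype α] [DecidableEq α] [Fintype β] {e : ℕ}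
    {K : Matrix α β ℂ[X]} (hK : HasGrade e K) {S : Matrix β α ℂ}
    (hS : K.map (fun p => p.coeff e) * S = 1) (i : α) : rowDegree K i = e := by
  refine le_antisymm (Finset.sup_le fun j _ => hK i j) ?_
  have := le_sup_natDegree_vecMul hK hS (t := Pi.single i 1)
    (by simp)
  simpa [rowDegree] using this

/-- A right invertible matrix polynomial of grade `e` with independent coefficients of degree `e` is
a minimal basis. -/
theorem isMinimalBasis_of_mul_eq_one {α β : Type*} [Fintype α] [DecidableEq α] [Fintype β] {e : ℕ}
    {K : Matrix α β ℂ[X]} (hK : HasGrade e K) {R : Matrix β α ℂ[X]} (h : K * R = 1)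
    {S : Matrix β α ℂ} (hS : K.map (fun p => p.coeff e) * S = 1) : IsMinimalBasis K := by
  -- The comparison can be made row by row: each row of `K` has degree exactly `e`, and each row of
  -- `G` is a nonzero polynomial combination of the rows of `K`.
  refine ⟨linearIndependent_ratRow_of_mul_eq_one h, fun G hG hspan =>
    Finset.sum_le_sum fun i _ => ?_⟩
  rw [rowDegree_eq_of_hasGrade hK hS]
  obtain ⟨t, ht⟩ := exists_vecMul_eq_of_mem_span h (g := G i)
    (hspan ▸ Submodule.subset_span ⟨i, rfl⟩)
  rw [rowDegree, ← ht]
  refine le_sup_natDegree_vecMul hK hS ?_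
  rintro rfl
  refine hG.ne_zero i ?_
  ext1 j
  simp [ratRow, ← ht]

/-! ### Grades and reversals -/

theorem hasGrade_mul {α β γ : Type*} [Fintype β] {a b : ℕ} {A : Matrix α β ℂ[X]}
    {B : Matrix β γ ℂ[X]} (hA : HasGrade a A) (hB : HasGrade b B) : HasGrade (a + b) (A * B) :=
  fun i j => natDegree_sum_le_of_forall_le _ _ fun l _ =>
    natDegree_mul_le_of_le (hA i l) (hB l j)

theorem hasGrade_add {α β : Type*} {a : ℕ} {A B : Matrix α β ℂ[X]} (hA : HasGrade a A)
    (hB : HasGrade a B) : HasGrade a (A + B) :=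
  fun i j => natDegree_add_le_of_degree_le (hA i j) (hB i j)

theorem hasGrade_transpose {α β : Type*} {a : ℕ} {A : Matrix α β ℂ[X]} (hA : HasGrade a A) :
    HasGrade a A.transpose :=
  fun i j => hA j i

theorem hasGrade_map_C {α β : Type*} (A : Matrix α β ℂ) : HasGrade 0 (A.map C) :=
  fun i j => by simp

theorem hasGrade_fromBlocks {α β γ δ : Type*} {a : ℕ} {A : Matrix α γ ℂ[X]} {B : Matrix α δ ℂ[X]}
    {A' : Matrix β γ ℂ[X]} {B' : Matrix β δ ℂ[X]} (hA : HasGrade a A) (hB : HasGrade a B)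
    (hA' : HasGrade a A') (hB' : HasGrade a B') : HasGrade a (Matrix.fromBlocks A B A' B') := by
  rintro (i | i) (j | j)
  exacts [hA i j, hB i j, hA' i j, hB' i j]

theorem hasGrade_matrixRev {α β : Type*} {k : ℕ} {P : Matrix α β ℂ[X]} (hP : HasGrade k P) :
    HasGrade k (matrixRev k P) :=
  fun i j => (natDegree_reflect_le).trans (max_le le_rfl (hP i j))

theorem matrixRev_mul {α β γ : Type*} [Fintype β] {a b : ℕ} {A : Matrix α β ℂ[X]}
    {B : Matrix β γ ℂ[X]} (hA : HasGrade a A) (hB : HasGrade b B) :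
    matrixRev (a + b) (A * B) = matrixRev a A * matrixRev b B := by
  ext1 i j
  have hsum : ∀ (s : Finset β) (f : β → ℂ[X]),
      reflect (a + b) (∑ l ∈ s, f l) = ∑ l ∈ s, reflect (a + b) (f l) := fun s f => by
    classical
    induction s using Finset.induction_on with
    | empty => simp
    | insert l s hl ih => rw [Finset.sum_insert hl, Finset.sum_insert hl, reflect_add, ih]
  simp only [matrixRev, Matrix.map_apply, Matrix.mul_apply]
  rw [hsum]
  exact Finset.sum_congr rfl fun l _ => reflect_mul _ _ (hA i l) (hB l j)

theorem matrixRev_fromBlocks {α β γ δ : Type*} (a : ℕ) (A : Matrix α γ ℂ[X]) (B : Matrix α δ ℂ[X])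
    (A' : Matrix β γ ℂ[X]) (B' : Matrix β δ ℂ[X]) : matrixRev a (Matrix.fromBlocks A B A' B') =
      Matrix.fromBlocks (matrixRev a A) (matrixRev a B) (matrixRev a A') (matrixRev a B') :=
  Matrix.fromBlocks_map _ _ _ _ _

/-- A right inverse of the reversal yields a right inverse of the matrix of coefficients of the
degree equal to the grade. -/
theorem exists_coeff_mul_eq_one {α β : Type*} [Fintype α] [DecidableEq α] [Fintype β] {e : ℕ}
    {K : Matrix α β ℂ[X]} {R : Matrix β α ℂ[X]} (h : matrixRev e K * R = 1) :
    ∃ S : Matrix β α ℂ, K.map (fun p => p.coeff e) * S = 1 := by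
  -- The value of the reversal at `0` is the matrix of coefficients of degree `e`.
  refine ⟨R.map (evalRingHom 0), ?_⟩
  have h1 := congrArg (fun A : Matrix α α ℂ[X] => A.map (evalRingHom (0 : ℂ))) h
  simp only [Matrix.map_mul] at h1
  rw [Matrix.map_one _ (map_zero _) (map_one _)] at h1
  rw [← h1]
  congr 1
  ext1 i j
  simp [matrixRev, ← coeff_zero_eq_eval_zero, coeff_reflect, revAt_le]

/-! ### Dual pairs -/

/-- The row spaces of the pencil `K` and of `D`, of grade `e`, are dual, and `K`, `D` and their
reversals are right invertible. -/
structure IsDualPair {α δ β : Type*} [Fintype α] [DecidableEq α] [Fintype δ] [DecidableEq δ]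
    [Fintype β] (e : ℕ) (K : Matrix α β ℂ[X]) (D : Matrix δ β ℂ[X]) : Prop where
  grade_left : HasGrade 1 K
  grade_right : HasGrade e D
  card_add : Fintype.card α + Fintype.card δ = Fintype.card β
  mul_transpose : K * D.transpose = 0
  left_inv : ∃ R : Matrix β α ℂ[X], K * R = 1
  right_inv : ∃ E : Matrix β δ ℂ[X], D * E = 1
  rev_left_inv : ∃ R : Matrix β α ℂ[X], matrixRev 1 K * R = 1
  rev_right_inv : ∃ E : Matrix β δ ℂ[X], matrixRev e D * E = 1

theorem IsDualPair.rev_mul_transpose {α δ β : Type*} [Fintype α] [DecidableEq α] [Fintype δ]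
    [DecidableEq δ] [Fintype β] {e : ℕ} {K : Matrix α β ℂ[X]} {D : Matrix δ β ℂ[X]}
    (h : IsDualPair e K D) : matrixRev 1 K * (matrixRev e D).transpose = 0 := by
  have := matrixRev_mul h.grade_left (hasGrade_transpose h.grade_right)
  rw [h.mul_transpose] at this
  refine Eq.trans this.symm ?_
  ext1 i j
  simp [matrixRev]

theorem IsDualPair.isStrongWing {α β : Type*} [Fintype α] [DecidableEq α] [Fintype β] {d e : ℕ}
    {K : Matrix α β ℂ[X]} {D : Matrix (Fin d) β ℂ[X]} (h : IsDualPair e K D) :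
    IsStrongWing K := by
  obtain ⟨R, hR⟩ := h.left_inv
  obtain ⟨E, hE⟩ := h.right_inv
  obtain ⟨R', hR'⟩ := h.rev_left_inv
  obtain ⟨E', hE'⟩ := h.rev_right_inv
  obtain ⟨S, hS⟩ := exists_coeff_mul_eq_one hR'
  obtain ⟨T, hT⟩ := exists_coeff_mul_eq_one hE'
  have hK := isMinimalBasis_of_mul_eq_one h.grade_left hR hS
  exact ⟨hK, rowDegree_eq_of_hasGrade h.grade_left hS, d, D, e,
    ⟨hK, isMinimalBasis_of_mul_eq_one h.grade_right hE hT, h.card_add, h.mul_transpose⟩,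
    rowDegree_eq_of_hasGrade h.grade_right hT⟩

/-! ### Unimodular reduction of block pencils -/

theorem isUnimodular_of_isUnit {α : Type*} [Fintype α] [DecidableEq α] {U : Matrix α α ℂ[X]}
    (hU : IsUnit U) : IsUnimodular U := by
  obtain ⟨c, hc, hcU⟩ := isUnit_iff.1 ((Matrix.isUnit_iff_isUnit_det U).1 hU)
  exact ⟨c, hc.ne_zero, hcU.symm⟩

/-- Equal cardinalities allow `U` and `V` to be reindexed as square matrices, for which a one-sided
inverse suffices. -/
theorem isLinearization_of_mul_mul_eq {α β σ ι κ : Type*} [Fintype α] [DecidableEq α] [Fintype β]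
    [DecidableEq β] [Fintype σ] [DecidableEq σ] [Fintype ι] [DecidableEq ι] [Fintype κ]
    [DecidableEq κ] {L : Matrix α β ℂ[X]} {P : Matrix ι κ ℂ[X]} (hL : HasGrade 1 L)
    (hα : Fintype.card α = Fintype.card (σ ⊕ ι)) (hβ : Fintype.card β = Fintype.card (σ ⊕ κ))
    {U : Matrix (σ ⊕ ι) α ℂ[X]} {U' : Matrix α (σ ⊕ ι) ℂ[X]} {V : Matrix β (σ ⊕ κ) ℂ[X]}
    {V' : Matrix (σ ⊕ κ) β ℂ[X]} (hU : U * U' = 1) (hV : V' * V = 1)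
    (h : U * L * V = Matrix.fromBlocks 1 0 0 P) : IsLinearization L P := by
  let e := Fintype.equivOfCardEq hα
  let f := Fintype.equivOfCardEq hβ
  let s := Fintype.equivFin σ
  refine ⟨hL, Fintype.card σ, e.trans (s.sumCongr (Equiv.refl ι)),
    f.trans (s.sumCongr (Equiv.refl κ)), U.submatrix e id, V.submatrix id f,
    isUnimodular_of_isUnit ?_, isUnimodular_of_isUnit ?_, ?_⟩
  · refine IsUnit.of_mul_eq_one (U'.submatrix id e) ?_
    rw [← Matrix.submatrix_mul _ _ _ _ _ Function.bijective_id, hU, Matrix.submatrix_one_equiv]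
  · refine IsUnit.of_mul_eq_one_right (V'.submatrix f id) ?_
    rw [← Matrix.submatrix_mul _ _ _ _ _ Function.bijective_id, hV, Matrix.submatrix_one_equiv]
  · have : U.submatrix e id * L * V.submatrix id f = (U * L * V).submatrix e f := by
      ext1 i j
      simp [Matrix.mul_apply]
    rw [this, h]
    ext1 i j
    rcases i with i | i <;> rcases j with j | j <;>
      simp [Matrix.one_apply]

/-- Correcting `R` by a multiple of `Dᵀ` does not affect `K * R`, because `K * Dᵀ = 0`. The outcome
says that `[K; E]` and `[R, Dᵀ]` multiply to the identity: a unimodular completion of `K` once the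
sizes match. -/
theorem exists_dual_right_inverse {α δ β : Type*} [Fintype α] [DecidableEq α] [Fintype δ]
    [DecidableEq δ] [Fintype β] {K : Matrix α β ℂ[X]} {D : Matrix δ β ℂ[X]}
    (h : K * D.transpose = 0) (hK : ∃ R : Matrix β α ℂ[X], K * R = 1)
    (hD : ∃ E : Matrix β δ ℂ[X], D * E = 1) :
    ∃ (R : Matrix β α ℂ[X]) (E : Matrix δ β ℂ[X]),
      K * R = 1 ∧ E * D.transpose = 1 ∧ E * R = 0 := by
  obtain ⟨R, hR⟩ := hK
  obtain ⟨E, hE⟩ := hD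
  have hE' : E.transpose * D.transpose = 1 := by
    rw [← Matrix.transpose_mul, hE, Matrix.transpose_one]
  refine ⟨R - D.transpose * (E.transpose * R), E.transpose, ?_, hE', ?_⟩
  · rw [Matrix.mul_sub, ← Matrix.mul_assoc, h, hR, Matrix.zero_mul, sub_zero]
  · rw [Matrix.mul_sub, ← Matrix.mul_assoc, hE', Matrix.one_mul, sub_self]

/-- A block minimal bases pencil is unimodularly equivalent to the block diagonal matrix with
diagonal blocks `1` and `D₂ * M * D₁ᵀ`. -/
theorem isLinearization_fromBlocks {α₁ α₂ δ₁ δ₂ β₁ β₂ : Type*} [Fintype α₁] [DecidableEq α₁]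
    [Fintype α₂] [DecidableEq α₂] [Fintype δ₁] [DecidableEq δ₁] [Fintype δ₂] [DecidableEq δ₂]
    [Fintype β₁] [DecidableEq β₁] [Fintype β₂] [DecidableEq β₂]
    {M : Matrix β₂ β₁ ℂ[X]} {K₁ : Matrix α₁ β₁ ℂ[X]} {K₂ : Matrix α₂ β₂ ℂ[X]}
    {D₁ : Matrix δ₁ β₁ ℂ[X]} {D₂ : Matrix δ₂ β₂ ℂ[X]}
    (hgrade : HasGrade 1 (Matrix.fromBlocks M K₂.transpose K₁ 0))
    (hc₁ : Fintype.card α₁ + Fintype.card δ₁ = Fintype.card β₁)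
    (hc₂ : Fintype.card α₂ + Fintype.card δ₂ = Fintype.card β₂)
    (h₁ : K₁ * D₁.transpose = 0) (h₂ : K₂ * D₂.transpose = 0)
    (hK₁ : ∃ R : Matrix β₁ α₁ ℂ[X], K₁ * R = 1) (hK₂ : ∃ R : Matrix β₂ α₂ ℂ[X], K₂ * R = 1)
    (hD₁ : ∃ E : Matrix β₁ δ₁ ℂ[X], D₁ * E = 1) (hD₂ : ∃ E : Matrix β₂ δ₂ ℂ[X], D₂ * E = 1) :
    IsLinearization (Matrix.fromBlocks M K₂.transpose K₁ 0) (D₂ * M * D₁.transpose) := by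
  obtain ⟨R₁, E₁, hKR₁, hED₁, hER₁⟩ := exists_dual_right_inverse h₁ hK₁ hD₁
  obtain ⟨R₂, E₂, hKR₂, hED₂, hER₂⟩ := exists_dual_right_inverse h₂ hK₂ hD₂
  have hDK : D₂ * K₂.transpose = 0 := by simpa using congrArg Matrix.transpose h₂
  have hRK : R₂.transpose * K₂.transpose = 1 := by
    rw [← Matrix.transpose_mul, hKR₂, Matrix.transpose_one]
  have hDE : D₂ * E₂.transpose = 1 := by simpa using congrArg Matrix.transpose hED₂
  have hRE : R₂.transpose * E₂.transpose = 0 := by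
    rw [← Matrix.transpose_mul, hER₂, Matrix.transpose_zero]
  -- Multiplying the body by `[R₂ᵀ; D₂]` and `[R₁, D₁ᵀ]` splits it into four blocks. The identities
  -- `K₁ * R₁ = 1` and `R₂ᵀ * K₂ᵀ = 1` act as pivots that clear all of them except `D₂ * M * D₁ᵀ`;
  -- the negated entries of `U` and `V` perform this elimination.
  refine isLinearization_of_mul_mul_eq (σ := α₁ ⊕ α₂) hgrade
    (by simp only [Fintype.card_sum]; omega) (by simp only [Fintype.card_sum]; omega)
    (U := .fromRows (.fromRows (.fromCols 0 1) (.fromCols R₂.transpose (-(R₂.transpose * M * R₁))))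
      (.fromCols D₂ (-(D₂ * M * R₁))))
    (U' := .fromCols (.fromCols
      (.fromRows (K₂.transpose * (R₂.transpose * M * R₁) + E₂.transpose * (D₂ * M * R₁)) 1)
      (.fromRows K₂.transpose 0)) (.fromRows E₂.transpose 0))
    (V := .fromCols (.fromCols (.fromRows R₁ 0) (.fromRows 0 1))
      (.fromRows D₁.transpose (-(R₂.transpose * M * D₁.transpose))))
    (V' := .fromRows (.fromRows (.fromCols K₁ 0)
      (.fromCols (R₂.transpose * M * D₁.transpose * E₁) 1)) (.fromCols E₁ 0)) ?_ ?_ ?_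
  · simp only [Matrix.fromRows_mul, Matrix.mul_fromCols, Matrix.fromCols_mul_fromRows]
    simp only [Matrix.mul_add, ← Matrix.mul_assoc, hDK, hRK, hDE, hRE]
    ext1 ((i | i) | i) ((j | j) | j) <;> simp [Matrix.one_apply]
  · simp only [Matrix.fromRows_mul, Matrix.mul_fromCols, Matrix.fromCols_mul_fromRows]
    simp only [Matrix.mul_assoc, h₁, hKR₁, hED₁, hER₁]
    ext1 ((i | i) | i) ((j | j) | j) <;> simp [Matrix.one_apply]
  · simp only [Matrix.fromRows_mul, Matrix.mul_fromCols, Matrix.fromCols_mul_fromRows,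
      Matrix.fromCols_mul_fromBlocks]
    simp only [Matrix.add_mul, Matrix.mul_assoc, Matrix.neg_mul, hRK, hDK]
    ext1 ((i | i) | i) ((j | j) | j) <;> simp [Matrix.one_apply, h₁, hKR₁]

/-- At grade `e₂ + 1 + e₁` the reversal distributes over the three factors, so the reversed pencil
is again a block pencil with dual wings, now for the reversed product. -/
theorem isStrongLinearization_fromBlocks {α₁ α₂ δ₁ δ₂ β₁ β₂ : Type*} [Fintype α₁] [DecidableEq α₁]
    [Fintype α₂] [DecidableEq α₂] [Fintype δ₁] [DecidableEq δ₁] [Fintype δ₂] [DecidableEq δ₂]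
    [Fintype β₁] [DecidableEq β₁] [Fintype β₂] [DecidableEq β₂] {e₁ e₂ : ℕ}
    {M : Matrix β₂ β₁ ℂ[X]} {K₁ : Matrix α₁ β₁ ℂ[X]} {K₂ : Matrix α₂ β₂ ℂ[X]}
    {D₁ : Matrix δ₁ β₁ ℂ[X]} {D₂ : Matrix δ₂ β₂ ℂ[X]} (hM : HasGrade 1 M)
    (h₁ : IsDualPair e₁ K₁ D₁) (h₂ : IsDualPair e₂ K₂ D₂) :
    IsStrongLinearization (e₂ + 1 + e₁) (Matrix.fromBlocks M K₂.transpose K₁ 0)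
      (D₂ * M * D₁.transpose) := by
  have hL : HasGrade 1 (Matrix.fromBlocks M K₂.transpose K₁ 0) :=
    hasGrade_fromBlocks hM (hasGrade_transpose h₂.grade_left) h₁.grade_left fun i j => by simp
  have hDM := hasGrade_mul h₂.grade_right hM
  refine ⟨hasGrade_mul hDM (hasGrade_transpose h₁.grade_right),
    isLinearization_fromBlocks hL h₁.card_add h₂.card_add h₁.mul_transpose h₂.mul_transpose
      h₁.left_inv h₂.left_inv h₁.right_inv h₂.right_inv, ?_⟩
  have hL' : matrixRev 1 (Matrix.fromBlocks M K₂.transpose K₁ 0) =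
      Matrix.fromBlocks (matrixRev 1 M) (matrixRev 1 K₂).transpose (matrixRev 1 K₁) 0 := by
    rw [matrixRev_fromBlocks]
    congr 1
  rw [matrixRev_mul hDM (hasGrade_transpose h₁.grade_right), matrixRev_mul h₂.grade_right hM, hL']
  exact isLinearization_fromBlocks (hL' ▸ hasGrade_matrixRev hL) h₁.card_add h₂.card_add
    h₁.rev_mul_transpose h₂.rev_mul_transpose h₁.rev_left_inv h₂.rev_left_inv h₁.rev_right_inv
    h₂.rev_right_inv

/-! ### Block bidiagonal pencils and their duals -/

/-- The image of an upper bidiagonal matrix, with diagonal entries `a` and superdiagonal entries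
`b i` that generate the unit ideal with `a`, is everything. -/
theorem exists_bidiagonal_mul_eq_one {A : Type*} [CommRing A] (r : ℕ) (a : A) (b : ℕ → A)
    (hab : ∀ i, IsCoprime a (b i)) :
    ∃ R : Matrix (Fin (r + 1)) (Fin r) A,
      (Matrix.of fun (i : Fin r) (j : Fin (r + 1)) =>
        if (j : ℕ) = i then a else if (j : ℕ) = i + 1 then b i else 0) * R = 1 := by
  set K : Matrix (Fin r) (Fin (r + 1)) A := Matrix.of fun i j =>
    if (j : ℕ) = i then a else if (j : ℕ) = i + 1 then b i else 0 with hK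
  set S := LinearMap.range K.mulVecLin with hS
  have mem : ∀ j, K.col j ∈ S := fun j => ⟨Pi.single j 1, by simp⟩
  -- Elimination from the left: column `0` is `a` times a unit vector, and each later column brings
  -- one more factor `a`.
  have hfirst : ∀ i (hi : i < r), a ^ (i + 1) • (Pi.single ⟨i, hi⟩ 1 : Fin r → A) ∈ S := by
    intro i
    induction i with
    | zero =>
      intro hi
      convert mem ⟨0, by omega⟩ using 1
      ext l
      by_cases hl : l = ⟨0, hi⟩
      · subst hl; simp [hK]
      · have : (l : ℕ) ≠ 0 := fun h => hl (Fin.ext h)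
        simp [hK, hl, Ne.symm this]
    | succ i ih =>
      intro hi
      have h := S.sub_mem (S.smul_mem (a ^ (i + 1)) (mem ⟨i + 1, by omega⟩))
        (S.smul_mem (b i) (ih (by omega)))
      convert h using 1
      ext l
      by_cases hl : l = ⟨i + 1, hi⟩
      · subst hl; simp [hK, pow_succ]
      · by_cases hl' : l = ⟨i, by omega⟩
        · subst hl'; simp [hK]; ring
        · have h1 : (l : ℕ) ≠ i + 1 := fun h => hl (Fin.ext h)
          have h2 : (l : ℕ) ≠ i := fun h => hl' (Fin.ext h)
          simp [hK, hl, hl', Ne.symm h1, Ne.symm h2]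
  -- Elimination from the right: the last column is `b (r - 1)` times a unit vector. The induction
  -- is on the distance `d` from the last row.
  have hlast : ∀ d i (hi : i < r), i + d + 1 = r →
      (∏ l ∈ Finset.Icc i (i + d), b l) • (Pi.single ⟨i, hi⟩ 1 : Fin r → A) ∈ S := by
    intro d
    induction d with
    | zero =>
      intro i hi hr
      convert mem ⟨i + 1, by omega⟩ using 1
      ext l
      by_cases hl : l = ⟨i, hi⟩
      · subst hl; simp [hK]
      · have h2 : (l : ℕ) ≠ i := fun h => hl (Fin.ext h)
        have := l.2
        simp [hK, hl, Ne.symm h2, show ¬ i + 1 = (l : ℕ) by omega]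
    | succ d ih =>
      intro i hi hr
      have h := S.sub_mem
        (S.smul_mem (∏ l ∈ Finset.Icc (i + 1) (i + 1 + d), b l) (mem ⟨i + 1, by omega⟩))
        (S.smul_mem a (ih (i + 1) (by omega) (by omega)))
      convert h using 1
      have hprod : ∏ l ∈ Finset.Icc i (i + (d + 1)), b l =
          b i * ∏ l ∈ Finset.Icc (i + 1) (i + 1 + d), b l := by
        rw [show i + 1 + d = i + (d + 1) by omega,
          ← Finset.mul_prod_Ioc_eq_prod_Icc (by omega), Finset.Icc_add_one_left_eq_Ioc]
      rw [hprod]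
      ext l
      by_cases hl : l = ⟨i + 1, by omega⟩
      · subst hl; simp [hK]; ring
      · by_cases hl' : l = ⟨i, by omega⟩
        · subst hl'; simp [hK]; ring
        · have h1 : (l : ℕ) ≠ i + 1 := fun h => hl (Fin.ext h)
          have h2 : (l : ℕ) ≠ i := fun h => hl' (Fin.ext h)
          simp [hK, hl, hl', Ne.symm h1, Ne.symm h2]
  have hsingle : ∀ i : Fin r, ∃ v, K.mulVec v = Pi.single i 1 := by
    intro i
    -- The two multiples of the same unit vector have coprime factors, so a Bézout combination
    -- yields the vector itself.
    obtain ⟨u, v, huv⟩ : IsCoprime (a ^ ((i : ℕ) + 1))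
        (∏ l ∈ Finset.Icc (i : ℕ) (i + (r - 1 - i)), b l) :=
      IsCoprime.pow_left (IsCoprime.prod_right fun l _ => hab l)
    have h := S.add_mem (S.smul_mem u (hfirst i i.2))
      (S.smul_mem v (hlast (r - 1 - i) i i.2 (by omega)))
    rw [smul_smul, smul_smul, ← add_smul, huv, one_smul] at h
    exact h
  choose v hv using hsingle
  refine ⟨(Matrix.of v).transpose, ?_⟩
  ext1 i j
  have := congrFun (hv j) i
  simpa [Matrix.mul_apply, Matrix.mulVec, dotProduct, Matrix.one_apply, Pi.single_apply] using this

/-- The matrix polynomial `[g 0 ⋯ g (r-1) I_n, …, g (r-1) I_n, I_n]`, dual to the block bidiagonal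
matrix with factors `g 0, …, g (r-1)`. -/
noncomputable def bidiagonalDual (r c n : ℕ) (g : ℕ → ℂ[X]) : Matrix (Fin n) (Fin c × Fin n) ℂ[X] :=
  Matrix.of fun a j => if a = j.2 then ∏ l ∈ Finset.Ico (j.1 : ℕ) r, g l else 0

/-- The block matrix is the Kronecker product of the scalar one with an identity. The pencil is the
case `a = -1`, its reversal the case `a = -X`. -/
theorem exists_blockwise_bidiagonal_mul_eq_one {r n : ℕ} (a : ℂ[X]) (g : ℕ → ℂ[X])
    (hg : ∀ i, IsCoprime a (g i)) : ∃ R : Matrix (Fin (r + 1) × Fin n) (Fin r × Fin n) ℂ[X],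
      (Matrix.of fun (i : Fin r × Fin n) (j : Fin (r + 1) × Fin n) => if i.2 = j.2 then
        if (j.1 : ℕ) = i.1 then a else if (j.1 : ℕ) = i.1 + 1 then g i.1 else 0
      else 0) * R = 1 := by
  obtain ⟨R, hR⟩ := exists_bidiagonal_mul_eq_one r a g hg
  refine ⟨Matrix.kronecker R 1, ?_⟩
  rw [← Matrix.one_kronecker_one, ← hR, ← Matrix.mul_one (1 : Matrix (Fin n) (Fin n) ℂ[X]),
    Matrix.mul_kronecker_mul, Matrix.mul_one]
  congr 1
  ext1 i j
  simp [Matrix.one_apply]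

theorem blockRow_mul_blockCol {c n : ℕ} {d v : Fin c → ℂ[X]} (hv : ∑ j, d j * v j = 1) :
    (Matrix.of fun (a : Fin n) (j : Fin c × Fin n) => if a = j.2 then d j.1 else 0) *
      (Matrix.of fun (j : Fin c × Fin n) (a : Fin n) => if a = j.2 then v j.1 else 0) = 1 := by
  ext1 a b
  simp only [Matrix.mul_apply, Fintype.sum_prod_type, Matrix.of_apply, ite_mul, zero_mul, mul_ite,
    mul_zero]
  by_cases hab : a = b
  · subst hab
    simpa using hv
  · rw [Matrix.one_apply_ne hab]
    exact Finset.sum_eq_zero fun i _ => Finset.sum_eq_zero fun j _ => by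
      split_ifs with h1 h2 <;> simp_all

theorem sum_bidiagonal_mul {r : ℕ} (i : Fin r) (a b : ℂ[X]) (f : ℕ → ℂ[X]) :
    ∑ j : Fin (r + 1), (if (j : ℕ) = i then a else if (j : ℕ) = i + 1 then b else 0) * f j =
      a * f i + b * f (i + 1) := by
  have h1 : ∀ j : Fin (r + 1),
      (if (j : ℕ) = i then a else if (j : ℕ) = i + 1 then b else 0) * f j =
        (if j = i.castSucc then a * f j else 0) + (if j = i.succ then b * f j else 0) := by
    intro j
    simp only [Fin.ext_iff, Fin.val_castSucc, Fin.val_succ]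
    split_ifs with h2 h3 h3
    · omega
    all_goals simp
  simp only [h1, Finset.sum_add_distrib, Finset.sum_ite_eq', Finset.mem_univ, if_true,
    Fin.val_castSucc, Fin.val_succ]

theorem natDegree_prod_Ico_X_sub_C {y : ℕ → ℂ} (j r : ℕ) :
    (∏ l ∈ Finset.Ico j r, (X - C (y l))).natDegree = r - j := by
  simp [natDegree_prod_of_monic, monic_X_sub_C]

theorem blockBidiagonal_mul_bidiagonalDual {r n : ℕ} (g : ℕ → ℂ[X]) :
    blockBidiagonal r (r + 1) n g * (bidiagonalDual r (r + 1) n g).transpose = 0 := by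
  ext1 i b
  simp only [Matrix.mul_apply, Fintype.sum_prod_type]
  rw [Finset.sum_comm]
  refine Finset.sum_eq_zero fun a _ => ?_
  simp only [blockBidiagonal, bidiagonalDual, Matrix.transpose_apply, Matrix.of_apply]
  by_cases hi : i.2 = a
  · by_cases hb : b = a
    · simp only [hi, hb, if_true]
      rw [sum_bidiagonal_mul i.1 (-1) (g i.1) fun j => ∏ l ∈ Finset.Ico j r, g l,
        Finset.prod_eq_prod_Ico_succ_bot i.1.2]
      ring
    · simp [hb]
  · simp [hi]

theorem matrixRev_blockBidiagonal (r c n : ℕ) (y : ℕ → ℂ) :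
    matrixRev 1 (blockBidiagonal r c n fun i => X - C (y i)) =
      Matrix.of fun (i : Fin r × Fin n) (j : Fin c × Fin n) => if i.2 = j.2 then
        if (j.1 : ℕ) = i.1 then -X else if (j.1 : ℕ) = i.1 + 1 then 1 - C (y i.1) * X else 0
      else 0 := by
  have h1 : reflect 1 (-1 : ℂ[X]) = -X := by
    rw [reflect_neg, reflect_one, pow_one]
  have h2 : ∀ z : ℂ, reflect 1 (X - C z) = 1 - C z * X := fun z => by
    rw [reflect_sub, reflect_C, pow_one, reflect_one_X]
  ext1 i j
  simp only [matrixRev, blockBidiagonal, Matrix.map_apply, Matrix.of_apply,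
    apply_ite (reflect 1), reflect_zero, h1, h2]

/-- The first and last blocks suffice. The first reverses a monic polynomial of degree `r`, so its
constant term is `1`; the last is the reversal `X ^ r` of `1`. These are coprime. -/
theorem exists_matrixRev_bidiagonalDual_mul (r n : ℕ) (y : ℕ → ℂ) :
    ∃ E : Matrix (Fin (r + 1) × Fin n) (Fin n) ℂ[X],
      matrixRev r (bidiagonalDual r (r + 1) n fun i => X - C (y i)) * E = 1 := by
  have hcop : IsCoprime (reflect r (∏ l ∈ Finset.Ico 0 r, (X - C (y l)))) (X ^ r) := by
    refine IsCoprime.pow_right (IsCoprime.symm ?_)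
    refine (Irreducible.coprime_iff_not_dvd irreducible_X).2 ?_
    have h1 := natDegree_prod_Ico_X_sub_C (y := y) 0 r
    have h2 : (∏ l ∈ Finset.Ico 0 r, (X - C (y l))).coeff r = 1 := by
      rw [Nat.sub_zero] at h1
      exact (monic_prod_of_monic _ _ fun l _ => monic_X_sub_C (y l)).coeff_natDegree ▸ by rw [h1]
    rw [X_dvd_iff, coeff_reflect, revAt_le (Nat.zero_le _), Nat.sub_zero, h2]
    exact one_ne_zero
  obtain ⟨u, v, huv⟩ := hcop
  have h : matrixRev r (bidiagonalDual r (r + 1) n fun i => X - C (y i)) =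
      Matrix.of fun (a : Fin n) (j : Fin (r + 1) × Fin n) =>
        if a = j.2 then reflect r (∏ l ∈ Finset.Ico (j.1 : ℕ) r, (X - C (y l))) else 0 := by
    ext1 a j
    simp only [matrixRev, bidiagonalDual, Matrix.map_apply, Matrix.of_apply,
      apply_ite (reflect r), reflect_zero]
  rw [h]
  refine ⟨_, blockRow_mul_blockCol
    (d := fun j : Fin (r + 1) => reflect r (∏ l ∈ Finset.Ico (j : ℕ) r, (X - C (y l))))
    (v := fun j => (if j = 0 then u else 0) + if j = Fin.last r then v else 0) ?_⟩
  simp only [mul_add, mul_ite, mul_zero, Finset.sum_add_distrib, Finset.sum_ite_eq',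
    Finset.mem_univ, if_true, Fin.val_zero, Fin.val_last, Finset.Ico_self, Finset.prod_empty,
    reflect_one]
  rw [← huv]
  ring

theorem exists_bidiagonalDual_mul (r n : ℕ) (g : ℕ → ℂ[X]) :
    ∃ E : Matrix (Fin (r + 1) × Fin n) (Fin n) ℂ[X], bidiagonalDual r (r + 1) n g * E = 1 := by
  refine ⟨_, blockRow_mul_blockCol
    (d := fun j : Fin (r + 1) => ∏ l ∈ Finset.Ico (j : ℕ) r, g l)
    (v := fun j => if j = Fin.last r then 1 else 0) ?_⟩
  simp

theorem hasGrade_blockBidiagonal (r c n : ℕ) (y : ℕ → ℂ) :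
    HasGrade 1 (blockBidiagonal r c n fun i => X - C (y i)) := by
  intro i j
  simp only [blockBidiagonal, Matrix.of_apply]
  split_ifs <;> simp

theorem hasGrade_bidiagonalDual (r c n : ℕ) (y : ℕ → ℂ) :
    HasGrade r (bidiagonalDual r c n fun i => X - C (y i)) := by
  intro i j
  simp only [bidiagonalDual, Matrix.of_apply]
  split_ifs
  · rw [natDegree_prod_Ico_X_sub_C]; omega
  · simp

theorem exists_blockBidiagonal_mul (r n : ℕ) (g : ℕ → ℂ[X]) :
    ∃ R : Matrix (Fin (r + 1) × Fin n) (Fin r × Fin n) ℂ[X],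
      blockBidiagonal r (r + 1) n g * R = 1 := by
  unfold blockBidiagonal
  exact exists_blockwise_bidiagonal_mul_eq_one (-1) g fun i => isCoprime_one_left.neg_left

theorem exists_matrixRev_blockBidiagonal_mul (r n : ℕ) (y : ℕ → ℂ) :
    ∃ R : Matrix (Fin (r + 1) × Fin n) (Fin r × Fin n) ℂ[X],
      matrixRev 1 (blockBidiagonal r (r + 1) n fun i => X - C (y i)) * R = 1 := by
  rw [matrixRev_blockBidiagonal]
  exact exists_blockwise_bidiagonal_mul_eq_one (-X) (fun i => 1 - C (y i) * X)
    fun i => ⟨-C (y i), 1, by ring⟩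

theorem isDualPair_blockBidiagonal {r c n : ℕ} (hc : c = r + 1) (y : ℕ → ℂ) :
    IsDualPair r (blockBidiagonal r c n fun i => X - C (y i))
      (bidiagonalDual r c n fun i => X - C (y i)) := by
  subst hc
  refine ⟨hasGrade_blockBidiagonal _ _ _ _, hasGrade_bidiagonalDual _ _ _ _, ?_,
    blockBidiagonal_mul_bidiagonalDual _, exists_blockBidiagonal_mul _ _ _,
    exists_bidiagonalDual_mul _ _ _, exists_matrixRev_blockBidiagonal_mul _ _ _,
    exists_matrixRev_bidiagonalDual_mul _ _ _⟩
  simp only [Fintype.card_prod, Fintype.card_fin]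
  ring

/-! ### The Newton expansion as a product with the duals -/

theorem newtonPoly_mul_prod_nodeFactor (x : ℕ → ℂ) {N s j : ℕ} (hs : s ≤ N) (hj : j ≤ s) :
    newtonPoly x (N - s) * ∏ l ∈ Finset.Ico j s, nodeFactor x (N - l) = newtonPoly x (N - j) := by
  rw [Finset.prod_Ico_reflect _ _ (by omega)]
  simp only [newtonPoly, ← Finset.Ico_add_one_right_eq_Icc]
  rw [show N - s + 1 = N + 1 - s by omega, Finset.prod_Ico_consecutive _ (by omega) (by omega),
    show N + 1 - j = N - j + 1 by omega]

/-- Here `k = μ + r + 1`. The left product is `n_{μ-i}`, and the right one raises `n_μ` to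
`n_{μ+r-j}`. Hence the first row carries the Newton polynomials from `n_{k-1}` down to `n_μ`, the
rest of the last column those below `n_μ`, and `γ_k` turns `n_{k-1}` into `n_k`. -/
theorem sum_newtonPoly_eq (μ r : ℕ) (x : ℕ → ℂ) (p : ℕ → ℂ[X]) :
    ∑ i ∈ Finset.range (μ + r + 1 + 1), newtonPoly x i * p i =
      ∑ i ∈ Finset.range (μ + 1), ∑ j ∈ Finset.range (r + 1),
        (∏ l ∈ Finset.Ico i μ, nodeFactor x (μ - l)) *
        (if i = 0 then
          if j = 0 then nodeFactor x (μ + r + 1) * p (μ + r + 1) + p (μ + r) else p (μ + r - j)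
        else if j = r then p (μ - i) else 0) *
        ∏ l ∈ Finset.Ico j r, nodeFactor x (μ + r - l) := by
  have h₂ : ∀ i ≤ μ, ∏ l ∈ Finset.Ico i μ, nodeFactor x (μ - l) = newtonPoly x (μ - i) := by
    intro i hi
    rw [← newtonPoly_mul_prod_nodeFactor x le_rfl hi]
    simp [newtonPoly]
  have h₁ : ∀ j ≤ r, newtonPoly x μ * ∏ l ∈ Finset.Ico j r, nodeFactor x (μ + r - l) =
      newtonPoly x (μ + r - j) := by
    intro j hj
    rw [← newtonPoly_mul_prod_nodeFactor x (show r ≤ μ + r by omega) hj, Nat.add_sub_cancel]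
  have htop : newtonPoly x (μ + r + 1) = newtonPoly x (μ + r) * nodeFactor x (μ + r + 1) :=
    Finset.prod_Icc_succ_top (by omega) _
  rw [Finset.sum_range_succ' _ μ]
  -- Below the first row only `j = r` contributes. The index form `μ - 1 - i`, like `r + 1 - 1 - j`
  -- below, is the one that `Finset.sum_range_reflect` expects.
  have hrow : ∀ i ∈ Finset.range μ, ∑ j ∈ Finset.range (r + 1),
        (∏ l ∈ Finset.Ico (i + 1) μ, nodeFactor x (μ - l)) *
        (if i + 1 = 0 then
          if j = 0 then nodeFactor x (μ + r + 1) * p (μ + r + 1) + p (μ + r) else p (μ + r - j)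
        else if j = r then p (μ - (i + 1)) else 0) *
        ∏ l ∈ Finset.Ico j r, nodeFactor x (μ + r - l) =
      newtonPoly x (μ - 1 - i) * p (μ - 1 - i) := by
    intro i hi
    rw [Finset.sum_eq_single_of_mem r (by simp)]
    · have := Finset.mem_range.1 hi
      rw [h₂ _ (by omega), show μ - 1 - i = μ - (i + 1) by omega]
      simp
    · intro j _ hj
      simp [hj]
  have hzero : ∀ j ∈ Finset.range (r + 1),
        (∏ l ∈ Finset.Ico 0 μ, nodeFactor x (μ - l)) *
        (if 0 = 0 then
          if j = 0 then nodeFactor x (μ + r + 1) * p (μ + r + 1) + p (μ + r) else p (μ + r - j)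
        else if j = r then p (μ - 0) else 0) *
        ∏ l ∈ Finset.Ico j r, nodeFactor x (μ + r - l) =
      newtonPoly x (μ + (r + 1 - 1 - j)) * p (μ + (r + 1 - 1 - j)) +
        if j = 0 then newtonPoly x (μ + r + 1) * p (μ + r + 1) else 0 := by
    intro j hj
    have hj' := Finset.mem_range.1 hj
    rw [h₂ _ (by omega), Nat.sub_zero, mul_right_comm, h₁ _ (by omega), if_pos rfl,
      show μ + (r + 1 - 1 - j) = μ + r - j by omega]
    split_ifs with h
    · subst h
      rw [htop, Nat.sub_zero]
      ring
    · ring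
  rw [Finset.sum_congr rfl hrow, Finset.sum_congr rfl hzero, Finset.sum_add_distrib,
    Finset.sum_range_reflect (fun i => newtonPoly x i * p i),
    Finset.sum_range_reflect (fun i => newtonPoly x (μ + i) * p (μ + i)),
    Finset.sum_ite_eq', if_pos (by simp), Finset.sum_range_succ, show μ + r + 1 = μ + (r + 1) from
    rfl, Finset.sum_range_add]
  ring

theorem newtonMatrixPoly_eq {m n : ℕ} (k μ : ℕ) (hμ : μ < k) (x : ℕ → ℂ)
    (P : ℕ → Matrix (Fin m) (Fin n) ℂ) :
    newtonMatrixPoly k x P =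
      bidiagonalDual μ (μ + 1) m (fun i => X - C (x (μ - i))) * newtonBody k μ x P *
        (bidiagonalDual (k - μ - 1) (k - μ) n fun i => X - C (x (k - 1 - i))).transpose := by
  obtain ⟨r, rfl⟩ := Nat.exists_eq_add_of_lt hμ
  have hr : μ + r + 1 - μ = r + 1 := by omega
  ext1 a b
  have hsum := sum_newtonPoly_eq μ r x fun i => C (P i a b)
  simp only [newtonMatrixPoly, Matrix.sum_apply, Matrix.smul_apply, Matrix.map_apply, smul_eq_mul]
  rw [hsum, Finset.sum_comm]
  simp only [Matrix.mul_apply, Matrix.transpose_apply, bidiagonalDual, newtonBody, Matrix.of_apply,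
    Fintype.sum_prod_type, ite_mul, zero_mul, mul_ite, mul_zero, Finset.sum_ite_eq,
    Finset.mem_univ, if_true]
  rw [← hr, ← Fin.sum_univ_eq_sum_range]
  refine Finset.sum_congr rfl fun j _ => ?_
  rw [← Fin.sum_univ_eq_sum_range, Finset.sum_mul]
  refine Finset.sum_congr rfl fun i _ => ?_
  simp only [hr, Nat.add_sub_cancel, nodeFactor]
  split_ifs <;> simp

theorem hasGrade_newtonBody {m n : ℕ} (k μ : ℕ) (x : ℕ → ℂ)
    (P : ℕ → Matrix (Fin m) (Fin n) ℂ) : HasGrade 1 (newtonBody k μ x P) := by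
  intro i j
  simp only [newtonBody, Matrix.of_apply, nodeFactor]
  split_ifs
  · compute_degree
  all_goals simp

/-! ### Colleague Newton pencils -/

theorem newtonPencil_strong {m n : ℕ} (k μ : ℕ) (hμ : μ < k) (x : ℕ → ℂ)
    (P : ℕ → Matrix (Fin m) (Fin n) ℂ)
    (A : Matrix (Fin (μ + 1) × Fin m) (Fin (k - μ - 1) × Fin n) ℂ)
    (B : Matrix (Fin μ × Fin m) (Fin (k - μ) × Fin n) ℂ) :
    IsStrongBlockMinimalBasisPencil
        (newtonPencil k μ x
          (newtonBody k μ x P + A.map C * newtonK₁ k μ n x +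
            (newtonK₂ μ m x).transpose * B.map C)) ∧
      IsStrongLinearization k
        (newtonPencil k μ x
          (newtonBody k μ x P + A.map C * newtonK₁ k μ n x +
            (newtonK₂ μ m x).transpose * B.map C))
        (newtonMatrixPoly k x P) := by
  have h₁ : IsDualPair (k - μ - 1) (newtonK₁ k μ n x)
      (bidiagonalDual (k - μ - 1) (k - μ) n fun i => X - C (x (k - 1 - i))) :=
    isDualPair_blockBidiagonal (by omega) _
  have h₂ : IsDualPair μ (newtonK₂ μ m x)
      (bidiagonalDual μ (μ + 1) m fun i => X - C (x (μ - i))) :=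
    isDualPair_blockBidiagonal rfl _
  have hM : HasGrade 1 (newtonBody k μ x P + A.map C * newtonK₁ k μ n x +
      (newtonK₂ μ m x).transpose * B.map C) :=
    hasGrade_add (hasGrade_add (hasGrade_newtonBody k μ x P)
      (by simpa using hasGrade_mul (hasGrade_map_C A) h₁.grade_left))
      (by simpa using hasGrade_mul (hasGrade_transpose h₂.grade_left) (hasGrade_map_C B))
  have hlin := isStrongLinearization_fromBlocks hM h₁ h₂
  -- Since `D₂ * K₂ᵀ = 0` and `K₁ * D₁ᵀ = 0`, the terms with `A` and `B` drop out of `D₂ * M * D₁ᵀ`.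
  have hDK := congrArg Matrix.transpose h₂.mul_transpose
  rw [Matrix.transpose_mul, Matrix.transpose_transpose, Matrix.transpose_zero] at hDK
  rw [Matrix.mul_add, Matrix.mul_add, ← Matrix.mul_assoc _ _ (B.map C), hDK, Matrix.zero_mul,
    add_zero, Matrix.add_mul, Matrix.mul_assoc _ (A.map C * _), Matrix.mul_assoc (A.map C),
    h₁.mul_transpose, Matrix.mul_zero, Matrix.mul_zero, add_zero,
    ← newtonMatrixPoly_eq k μ hμ x P, show μ + 1 + (k - μ - 1) = k by omega] at hlin
  exact ⟨⟨hlin.2.1.1, _, _, _, rfl, h₁.isStrongWing, h₂.isStrongWing⟩, hlin⟩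

theorem mainTheorem1 (k μ m n : ℕ) (hμ : μ < k) (x : ℕ → ℂ)
    (P : ℕ → Matrix (Fin m) (Fin n) ℂ) :
    (IsStrongBlockMinimalBasisPencil (newtonPencil k μ x (newtonBody k μ x P)) ∧
      IsStrongLinearization k (newtonPencil k μ x (newtonBody k μ x P))
        (newtonMatrixPoly k x P)) ∧
    ∀ (A : Matrix (Fin (μ + 1) × Fin m) (Fin (k - μ - 1) × Fin n) ℂ)
      (B : Matrix (Fin μ × Fin m) (Fin (k - μ) × Fin n) ℂ),
      IsStrongBlockMinimalBasisPencil
        (newtonPencil k μ x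
          (newtonBody k μ x P + A.map C * newtonK₁ k μ n x +
            (newtonK₂ μ m x).transpose * B.map C)) ∧
      IsStrongLinearization k
        (newtonPencil k μ x
          (newtonBody k μ x P + A.map C * newtonK₁ k μ n x +
            (newtonK₂ μ m x).transpose * B.map C))
        (newtonMatrixPoly k x P) := by
  refine ⟨?_, newtonPencil_strong k μ hμ x P⟩
  have h := newtonPencil_strong k μ hμ x P 0 0
  simpa only [Matrix.map_zero _ (map_zero C), Matrix.zero_mul, Matrix.mul_zero, add_zero] using h
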